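/- A \emph{stochastic combinatorial semi-bandit} consists of a ground set $E=\{1,\dots,L\}$, a non-empty family $\Theta\subseteq 2^E$ of solutions, and a probability distribution $P$ on $[0,1]^E$. Weights $w_1,w_2,\dots$ are drawn i.i.d. from $P$. At step $t$ an algorithm chooses $A_t\in\Theta$ as a (measurable) function of its earlier choices and observations and of its internal randomness, which is independent of the weights; it gains $f(A_t,w_t)=\sum_{e\in A_t}w_t(e)$ and observes $(w_t(e))_{e\in A_t}$. Its regret is $R(n)=\mathbb{E}\big[\sum_{t=1}^n (f(A^*,w_t)-f(A_t,w_t))\big]$, where $A^*\in\Theta$ maximizes the expected return $\mathbb{E}_{w\sim P}[f(A,w)]$. Let $K\ge 1$ divide $L$. For $j\in\{1,\dots,L/K\}$ and $0<\Delta/K<1/2$, the \emph{$K$-path semi-bandit with optimal path $j$ and gap $\Delta$} has as its solutions the $L/K$ disjoint paths $\{(i-1)K+1,\dots,iK\}$, $1\le i\le L/K$; the weights of items in the same path are equal, the weights of different paths are independent, and the weight of each item is a Bernoulli variable, with mean $1/2$ if the item belongs to path $j$, and $1/2-\Delta/K$ otherwise. Write $R_j(n)$ for the regret of a given algorithm on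 this problem. **Proposition.** Let $L$ and $K\ge 1$ be such that $L/K$ is an integer with $L/K\ge 2$, and let $n\ge 1$. There is a $\Delta$ with $0<\Delta/K<1/2$, depending only on $L$, $K$ and $n$, such that every (possibly randomized) algorithm, even one that knows $L$, $K$, $n$ and $\Delta$, satisfies $$\frac{1}{L/K}\sum_{j=1}^{L/K} R_j(n)\ \ge\ \frac1{20}\min\big(\sqrt{KLn},\,Kn\big).$$ That is, the bound holds for the expected regret on the random $K$-path semi-bandit whose optimal path is drawn uniformly at random (and is not known to the algorithm). In particular, for every algorithm there is a $K$-path semi-bandit, namely one with this gap $\Delta$ and a suitable optimal path $j$, on which $R_j(n)\ge\frac1{20}\min(\sqrt{KLn},Kn)$. -/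

import Mathlib

open MeasureTheory ProbabilityTheory

universe u

/-- A stochastic combinatorial semi-bandit `(E, Θ, P)` with ground set `E = Fin L`:
a non-empty family `Θ` of feasible subsets of `E` (the solutions) and a probability
distribution `P` over the unit cube `[0, 1]^E`, from which the item weights are drawn. -/
structure SemiBandit (L : ℕ) where
  feasible : Finset (Finset (Fin L))
  feasible_nonempty : feasible.Nonempty
  law : Measure (Fin L → ℝ)
  isProbabilityMeasure_law : IsProbabilityMeasure law
  law_cube : ∀ᵐ w ∂law, ∀ e, w e ∈ Set.Icc (0 : ℝ) 1

/-- The return `f(A, w) = ∑_{e ∈ A} w(e)` of the solution `A` under the weights `w`. -/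
def solutionReturn {L : ℕ} (A : Finset (Fin L)) (w : Fin L → ℝ) : ℝ := ∑ e ∈ A, w e

namespace SemiBandit

variable {L : ℕ}

/-- The expected weights of the items. -/
noncomputable def meanWeight (B : SemiBandit L) : Fin L → ℝ := fun e => ∫ w, w e ∂B.law

theorem exists_optimal (B : SemiBandit L) :
    ∃ A ∈ B.feasible, ∀ A' ∈ B.feasible,
      solutionReturn A' B.meanWeight ≤ solutionReturn A B.meanWeight :=
  B.feasible.exists_max_image (fun A => solutionReturn A B.meanWeight) B.feasible_nonempty

/-- An optimal solution: a maximizer over the feasible set of the return under the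
expected weights. -/
noncomputable def optimal (B : SemiBandit L) : Finset (Fin L) := Classical.choose B.exists_optimal

end SemiBandit

/-- What the agent sees at one step: the solution `A` that it chose, and the weights of the items
of `A` (the entries of the second component outside `A` are set to `0` and carry no information). -/
abbrev Observation (L : ℕ) : Type := Finset (Fin L) × (Fin L → ℝ)

/-- The semi-bandit feedback for choosing `A` when the weights are `w`. -/
def observe {L : ℕ} (A : Finset (Fin L)) (w : Fin L → ℝ) : Observation L :=
  (A, fun e => if e ∈ A then w e else 0)

/-- A (possibly randomized) learning algorithm for semi-bandits with feasible set `Θ`. The internal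
randomness is a random seed. The solution chosen after `t` completed steps is a measurable function
of the seed and of the `t` observations made so far. -/
structure SemiBanditAlgorithm {L : ℕ} (Θ : Finset (Finset (Fin L))) where
  Seed : Type u
  [measurableSpaceSeed : MeasurableSpace Seed]
  seedLaw : Measure Seed
  [isProbabilityMeasure_seedLaw : IsProbabilityMeasure seedLaw]
  choose : (t : ℕ) → Seed × (Fin t → Observation L) → Finset (Fin L)
  choose_mem : ∀ t x, choose t x ∈ Θ
  measurable_choose : ∀ t, Measurable (choose t)

attribute [instance] SemiBanditAlgorithm.measurableSpaceSeed
  SemiBanditAlgorithm.isProbabilityMeasure_seedLaw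

namespace SemiBanditAlgorithm

variable {L : ℕ} {Θ : Finset (Finset (Fin L))}

/-- The first `t ≤ n` observations of the algorithm, when its seed is `s` and the weights in the
`n` steps are `w 0, …, w (n - 1)`. -/
def history (alg : SemiBanditAlgorithm.{u} Θ) {n : ℕ} (s : alg.Seed) (w : Fin n → Fin L → ℝ) :
    (t : ℕ) → t ≤ n → (Fin t → Observation L)
  | 0, _ => Fin.elim0
  | t + 1, h =>
    Fin.snoc (α := fun _ => Observation L) (alg.history s w t (Nat.le_of_succ_le h))
      (observe (alg.choose t (s, alg.history s w t (Nat.le_of_succ_le h))) (w ⟨t, h⟩))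

/-- The solution chosen at step `t`. -/
def action (alg : SemiBanditAlgorithm.{u} Θ) {n : ℕ} (s : alg.Seed) (w : Fin n → Fin L → ℝ)
    (t : Fin n) : Finset (Fin L) :=
  alg.choose t (s, alg.history s w t t.isLt.le)

end SemiBanditAlgorithm

/-- The expected `n`-step regret `R(n) = 𝔼[∑_t (f(A*, w_t) - f(A_t, w_t))]`: the weights `w_t` are
i.i.d. draws from the law of `B`, independent of the seed of the algorithm. -/
noncomputable def SemiBandit.regret {L : ℕ} (B : SemiBandit L)
    (alg : SemiBanditAlgorithm.{u} B.feasible) (n : ℕ) : ℝ :=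
  ∫ x : alg.Seed × (Fin n → Fin L → ℝ),
    ∑ t : Fin n, (solutionReturn B.optimal (x.2 t) - solutionReturn (alg.action x.1 x.2 t) (x.2 t))
    ∂(alg.seedLaw.prod (Measure.pi fun _ : Fin n => B.law))

section KPath

variable {L K : ℕ}

/-- The path that an item belongs to; path `i` consists of the items `i K, …, i K + K - 1`. -/
def pathIndex (h : K ∣ L) (e : Fin L) : Fin (L / K) :=
  ⟨e / K, Nat.div_lt_div_of_lt_of_dvd h e.isLt⟩

/-- The `i`-th path, as a set of items. -/
def pathItems (h : K ∣ L) (i : Fin (L / K)) : Finset (Fin L) :=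
  Finset.univ.filter fun e => pathIndex h e = i

/-- The feasible set of a `K`-path semi-bandit: its `L / K` paths. -/
def kPathFeasible (h : K ∣ L) : Finset (Finset (Fin L)) := Finset.univ.image (pathItems h)

theorem kPathMean_mem {m : ℕ} (j i : Fin m) {Δ : ℝ} (hΔ : 0 < Δ / K ∧ Δ / K < 1 / 2) :
    (if i = j then 1 / 2 else 1 / 2 - Δ / K : ℝ) ∈ unitInterval := by
  obtain ⟨h0, h1⟩ := hΔ
  split_ifs <;> constructor <;> linarith

/-- The mean weight of the items of path `i` in the `K`-path semi-bandit with optimal path `j`. -/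
noncomputable def kPathMean {m : ℕ} (j : Fin m) (Δ : ℝ) (hΔ : 0 < Δ / K ∧ Δ / K < 1 / 2)
    (i : Fin m) : unitInterval :=
  ⟨if i = j then 1 / 2 else 1 / 2 - Δ / K, kPathMean_mem j i hΔ⟩

/-- The law of the weights in the `K`-path semi-bandit with optimal path `j`: one Bernoulli
variable for each path, independent for different paths; all items of a path have its value as
their weight. -/
noncomputable def kPathLaw (h : K ∣ L) (j : Fin (L / K)) (Δ : ℝ)
    (hΔ : 0 < Δ / K ∧ Δ / K < 1 / 2) : Measure (Fin L → ℝ) :=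
  (Measure.pi fun i : Fin (L / K) => bernoulliMeasure (1 : ℝ) 0 (kPathMean j Δ hΔ i)).map
    fun x e => x (pathIndex h e)

theorem measurable_comp_pathIndex (h : K ∣ L) :
    Measurable fun (x : Fin (L / K) → ℝ) (e : Fin L) => x (pathIndex h e) := by
  fun_prop

theorem isProbabilityMeasure_kPathLaw (h : K ∣ L) (j : Fin (L / K)) (Δ : ℝ)
    (hΔ : 0 < Δ / K ∧ Δ / K < 1 / 2) : IsProbabilityMeasure (kPathLaw h j Δ hΔ) :=
  Measure.isProbabilityMeasure_map (measurable_comp_pathIndex h).aemeasurable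

theorem kPathLaw_cube (h : K ∣ L) (j : Fin (L / K)) (Δ : ℝ) (hΔ : 0 < Δ / K ∧ Δ / K < 1 / 2) :
    ∀ᵐ w ∂kPathLaw h j Δ hΔ, ∀ e, w e ∈ Set.Icc (0 : ℝ) 1 := by
  have hm : MeasurableSet {w : Fin L → ℝ | ∀ e, w e ∈ Set.Icc (0 : ℝ) 1} := by
    simp only [Set.ofPred_forall]
    exact MeasurableSet.iInter fun e => measurableSet_Icc.preimage (measurable_pi_apply e)
  rw [kPathLaw, ae_map_iff (measurable_comp_pathIndex h).aemeasurable hm]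
  have key : ∀ i : Fin (L / K), ∀ᵐ x ∂(Measure.pi fun i : Fin (L / K) =>
      bernoulliMeasure (1 : ℝ) 0 (kPathMean j Δ hΔ i)), x i ∈ Set.Icc (0 : ℝ) 1 := by
    intro i
    refine (Measure.quasiMeasurePreserving_eval (μ := fun i : Fin (L / K) =>
      bernoulliMeasure (1 : ℝ) 0 (kPathMean j Δ hΔ i)) i).ae ?_
    have : bernoulliMeasure (1 : ℝ) 0 (kPathMean j Δ hΔ i) (Set.Icc (0 : ℝ) 1)ᶜ = 0 :=
      bernoulliMeasure_apply_of_notMem_of_notMem _ measurableSet_Icc.compl (by simp) (by simp)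
    exact this
  filter_upwards [ae_all_iff.2 key] with x hx e using hx _

/-- The `K`-path semi-bandit in which path `j` is optimal: there are `L / K` disjoint paths of `K`
items each, the mean weight is `1/2` on path `j` and `1/2 - Δ / K` on all the other paths. -/
noncomputable def kPathBandit (h : K ∣ L) (j : Fin (L / K)) (Δ : ℝ)
    (hΔ : 0 < Δ / K ∧ Δ / K < 1 / 2) : SemiBandit L where
  feasible := kPathFeasible h
  feasible_nonempty := ⟨pathItems h j, Finset.mem_image_of_mem _ (Finset.mem_univ j)⟩
  law := kPathLaw h j Δ hΔ
  isProbabilityMeasure_law := isProbabilityMeasure_kPathLaw h j Δ hΔ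
  law_cube := kPathLaw_cube h j Δ hΔ

end KPath

/-! Write m = L/K and ε = Δ/K. Since the items of a path share one Bernoulli weight, a step of the
semi-bandit reveals a single bit, and for a fixed seed the algorithm is a deterministic policy for
an m-armed Bernoulli bandit whose best arm has mean 1/2 and whose other arms have mean 1/2 - ε. Its
regret is Δ times the expected number of pulls of the wrong arm.

The bandit with best arm a is compared with the base bandit, in which every arm has mean 1/2 - ε.
The two differ only when a is pulled, so up to step t their relative entropy is at most 4ε² times
the expected number of pulls of a in the base bandit. The entropy enters through its variational
(Donsker–Varadhan) form, `expect_le_log_expect_exp`, which passes through the tree by induction and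
needs no densities. Tested on minus the indicator that a is pulled, it bounds the probability of
pulling a when a is best by its base probability, plus the entropy term, plus 7/40
(`pullProb_gapMean_le`). Base probabilities sum to 1 over the arms, so summing over a and t bounds
the total number of correct pulls by n + 2ε²n² + (7/40)mn.

`integral_history` identifies the law of the history, given the seed, with the tree expectation. As
the bound is uniform in the seed, integrating over the seed covers randomized algorithms. Finally ε
= min(√(mn), n)/(4n) gives the constant 1/20. -/

/-! ### Expectations on decision trees -/

/-- A deterministic policy for a bandit with arms `α` and binary rewards, given as a decision tree:
`node t` is the type of possible situations after `t` steps. -/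
structure BernoulliPolicy (α : Type*) where
  node : ℕ → Type*
  root : node 0
  arm : (t : ℕ) → node t → α
  next : (t : ℕ) → node t → Bool → node (t + 1)

namespace BernoulliPolicy

variable {α : Type*} (π : BernoulliPolicy α)

/-- The conditional expectation of `g`, one step later, when the success probability of
arm `a` is `p a`. -/
def step (p : α → ℝ) (t : ℕ) (g : π.node (t + 1) → ℝ) (h : π.node t) : ℝ :=
  p (π.arm t h) * g (π.next t h true) + (1 - p (π.arm t h)) * g (π.next t h false)

/-- The expectation of a function of the situation after `t` steps. -/
def expect (p : α → ℝ) : (t : ℕ) → (π.node t → ℝ) → ℝ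
  | 0, g => g π.root
  -- The last reward is averaged out first, so inductions on the depth must keep `g` arbitrary.
  | t + 1, g => expect p t (π.step p t g)

variable {p : α → ℝ}

theorem expect_add (t : ℕ) (f g : π.node t → ℝ) :
    π.expect p t (fun h => f h + g h) = π.expect p t f + π.expect p t g := by
  induction t with
  | zero => rfl
  | succ t ih =>
    simp only [expect, ← ih]
    congr 1
    funext h
    simp only [step]
    ring

theorem expect_const_mul (t : ℕ) (c : ℝ) (g : π.node t → ℝ) :
    π.expect p t (fun h => c * g h) = c * π.expect p t g := by
  induction t with
  | zero => rfl
  | succ t ih =>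
    simp only [expect, ← ih]
    congr 1
    funext h
    simp only [step]
    ring

theorem expect_const (t : ℕ) (c : ℝ) : π.expect p t (fun _ => c) = c := by
  induction t with
  | zero => rfl
  | succ t ih =>
    simp only [expect]
    rw [← ih]
    congr 1
    funext h
    rw [ih]
    simp only [step]
    ring

theorem expect_sum {ι : Type*} (s : Finset ι) (t : ℕ) (f : ι → π.node t → ℝ) :
    π.expect p t (fun h => ∑ i ∈ s, f i h) = ∑ i ∈ s, π.expect p t (f i) := by
  classical
  induction s using Finset.induction_on with
  | empty => simp [expect_const]
  | insert i s hi ih =>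
    simp only [Finset.sum_insert hi, ← ih]
    exact π.expect_add t _ _

theorem expect_mono (hp : ∀ a, p a ∈ Set.Icc (0 : ℝ) 1) (t : ℕ) {f g : π.node t → ℝ}
    (hfg : ∀ h, f h ≤ g h) : π.expect p t f ≤ π.expect p t g := by
  induction t with
  | zero => exact hfg _
  | succ t ih =>
    refine ih fun h => ?_
    obtain ⟨h0, h1⟩ := hp (π.arm t h)
    have := mul_le_mul_of_nonneg_left (hfg (π.next t h true)) h0
    have := mul_le_mul_of_nonneg_left (hfg (π.next t h false)) (sub_nonneg.2 h1)
    simp only [step]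
    linarith

open Classical in
/-- The probability that arm `a` is chosen after `t` steps. -/
noncomputable def pullProb (p : α → ℝ) (t : ℕ) (a : α) : ℝ :=
  π.expect p t fun h => if π.arm t h = a then 1 else 0

end BernoulliPolicy

/-! ### Numerical inequalities for entropy and logarithm -/

/-- The variational inequality for the relative entropy of a Bernoulli variable with mean
`1 / 2 - ε` with respect to a fair one. -/
theorem bernoulli_variational {ε : ℝ} (h0 : 0 ≤ ε) (h1 : ε < 1 / 2) (a b : ℝ) :
    (1 / 2 - ε) * a + (1 / 2 + ε) * b ≤
      4 * ε ^ 2 + Real.log (1 / 2 * Real.exp a + 1 / 2 * Real.exp b) := by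
  have hp : 0 < 1 / 2 - ε := by linarith
  have hq : 0 < 1 / 2 + ε := by linarith
  -- With p = 1/2 - ε and q = 1/2 + ε, the weights p, q are put on the points eᵃ/(2p), eᵇ/(2q).
  -- Taking logarithms leaves the relative entropy p log(2p) + q log(2q) as the error term.
  have jensen := strictConcaveOn_log_Ioi.concaveOn.2
    (show Real.exp a / (2 * (1 / 2 - ε)) ∈ Set.Ioi 0 from div_pos (Real.exp_pos a) (by linarith))
    (show Real.exp b / (2 * (1 / 2 + ε)) ∈ Set.Ioi 0 from div_pos (Real.exp_pos b) (by linarith))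
    hp.le hq.le (by ring)
  simp only [smul_eq_mul] at jensen
  rw [Real.log_div (Real.exp_pos a).ne' (by linarith), Real.log_div (Real.exp_pos b).ne'
    (by linarith), Real.log_exp, Real.log_exp] at jensen
  have e : (1 / 2 - ε) * (Real.exp a / (2 * (1 / 2 - ε))) +
      (1 / 2 + ε) * (Real.exp b / (2 * (1 / 2 + ε))) = 1 / 2 * Real.exp a + 1 / 2 * Real.exp b := by
    have (r x : ℝ) (hr : r ≠ 0) : r * (x / (2 * r)) = 1 / 2 * x := by field_simp
    rw [this _ _ hp.ne', this _ _ hq.ne']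
  rw [e] at jensen
  -- By log x ≤ x - 1, the entropy is at most p(2p - 1) + q(2q - 1) = -2εp + 2εq = 4ε².
  have k1 := mul_le_mul_of_nonneg_left
    (Real.log_le_sub_one_of_pos (show 0 < 2 * (1 / 2 - ε) by linarith)) hp.le
  have k2 := mul_le_mul_of_nonneg_left
    (Real.log_le_sub_one_of_pos (show 0 < 2 * (1 / 2 + ε) by linarith)) hq.le
  nlinarith

/-- With s = 1 - e⁻¹, the concave function log(1 - sx) lies below its tangent of slope -1, so log(1
- sx) + x ≤ log s + 1/s - 1, which is below 7/40 = 0.175. -/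
theorem log_one_sub_mul_le {x : ℝ} (h0 : 0 ≤ x) (h1 : x ≤ 1) :
    Real.log (1 + (Real.exp (-1) - 1) * x) ≤ 7 / 40 - x := by
  have hE : Real.exp (-1) ≤ 0.368 := by
    have := Real.exp_neg_one_lt_d9
    linarith
  have hE' : 0.367 ≤ Real.exp (-1) := by
    have := Real.exp_neg_one_gt_d9
    linarith
  have hu : 0 < 1 + (Real.exp (-1) - 1) * x := by nlinarith
  have hexp : (0.66 : ℝ) ≤ Real.exp (-0.41) := by
    have : Real.exp (0.41) ≤ 1 / 0.66 := by
      have := Real.exp_bound' (x := 0.41) (by norm_num) (by norm_num) (n := 4) (by norm_num)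
      simp [Finset.sum_range_succ, Nat.factorial] at this
      norm_num at this ⊢
      linarith
    rw [Real.exp_neg, le_inv_comm₀ (by norm_num) (Real.exp_pos _)]
    linarith
  have hs : Real.log (1 - Real.exp (-1)) ≤ -0.41 := by
    rw [Real.log_le_iff_le_exp (by linarith)]
    linarith
  have hspos : 0 < 1 - Real.exp (-1) := by linarith
  -- The tangent of slope -1 in x touches where 1 - sx = s, hence the division by s.
  have key := Real.log_le_sub_one_of_pos (div_pos hu hspos)
  rw [Real.log_div hu.ne' hspos.ne'] at key
  have e : (1 + (Real.exp (-1) - 1) * x) / (1 - Real.exp (-1)) = 1 / (1 - Real.exp (-1)) - x := by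
    field_simp
    ring
  rw [e] at key
  have hinv : 1 / (1 - Real.exp (-1)) ≤ 1.583 := by
    rw [div_le_iff₀ hspos]
    linarith
  linarith

/-! ### Change of measure and the number of correct pulls -/

open Classical in
/-- The success probabilities of a bandit with gap `ε` in which `a` is the best arm. -/
noncomputable def gapMean {α : Type*} (ε : ℝ) (a b : α) : ℝ := if b = a then 1 / 2 else 1 / 2 - ε

namespace BernoulliPolicy

variable {α : Type*} (π : BernoulliPolicy α)

theorem gapMean_mem {ε : ℝ} (h0 : 0 ≤ ε) (h1 : ε < 1 / 2) (a b : α) :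
    gapMean ε a b ∈ Set.Icc (0 : ℝ) 1 := by
  unfold gapMean
  split_ifs <;> constructor <;> linarith

/-- The Donsker–Varadhan inequality along the tree, with the chain rule for relative entropy built
into the induction: a step costs 4ε² if it pulls `a`, and nothing otherwise because the two bandits
then agree. -/
theorem expect_le_log_expect_exp {ε : ℝ} (h0 : 0 ≤ ε) (h1 : ε < 1 / 2) (a : α) (t : ℕ)
    (g : π.node t → ℝ) :
    π.expect (fun _ => 1 / 2 - ε) t g ≤
      4 * ε ^ 2 * ∑ u ∈ Finset.range t, π.pullProb (fun _ => 1 / 2 - ε) u a +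
        Real.log (π.expect (gapMean ε a) t fun h => Real.exp (g h)) := by
  classical
  induction t with
  | zero => simp [expect]
  | succ t ih =>
    set G := π.step (gapMean ε a) t fun h => Real.exp (g h) with hG
    have hGpos : ∀ h, 0 < G h := by
      intro h
      have e1 := Real.exp_pos (g (π.next t h true))
      have e2 := Real.exp_pos (g (π.next t h false))
      simp only [hG, step, gapMean]
      split_ifs
      · nlinarith
      · have := mul_pos (show 0 < 1 / 2 - ε by linarith) e1
        have := mul_pos (show 0 < 1 - (1 / 2 - ε) by linarith) e2
        linarith
    have hstep : ∀ h, π.step (fun _ => 1 / 2 - ε) t g h ≤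
        4 * ε ^ 2 * (if π.arm t h = a then 1 else 0) + Real.log (G h) := by
      intro h
      simp only [hG, step, gapMean]
      split_ifs with hh
      -- Arm `a` has different means in the two bandits. For any other arm, plain Jensen suffices.
      · have := bernoulli_variational h0 h1 (g (π.next t h true)) (g (π.next t h false))
        norm_num at this ⊢
        linarith
      · have := strictConcaveOn_log_Ioi.concaveOn.2
          (Real.exp_pos (g (π.next t h true))) (Real.exp_pos (g (π.next t h false)))
          (show 0 ≤ 1 / 2 - ε by linarith) (show 0 ≤ 1 - (1 / 2 - ε) by linarith) (by ring)
        simpa using this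
    calc π.expect (fun _ => 1 / 2 - ε) (t + 1) g
        ≤ π.expect (fun _ => 1 / 2 - ε) t fun h =>
            4 * ε ^ 2 * (if π.arm t h = a then 1 else 0) + Real.log (G h) :=
          π.expect_mono (fun _ => ⟨by linarith, by linarith⟩) t hstep
      _ = 4 * ε ^ 2 * π.pullProb (fun _ => 1 / 2 - ε) t a +
            π.expect (fun _ => 1 / 2 - ε) t fun h => Real.log (G h) := by
          rw [expect_add, expect_const_mul]
          simp only [pullProb]
      _ ≤ _ := by
          -- Exponentiating log G returns G, the one-step average of exp g, so the logarithmic term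
          -- reproduces itself.
          have := ih fun h => Real.log (G h)
          simp only [Real.exp_log (hGpos _)] at this
          rw [Finset.sum_range_succ, mul_add]
          have e : π.expect (gapMean ε a) (t + 1) (fun h => Real.exp (g h)) =
            π.expect (gapMean ε a) t G := rfl
          rw [e]
          linarith

/-- Takes the place of Pinsker's inequality: the entropy enters linearly, not under a square root,
at the price of the additive constant 7/40. -/
theorem pullProb_gapMean_le {ε : ℝ} (h0 : 0 ≤ ε) (h1 : ε < 1 / 2) (a : α) (t : ℕ) :
    π.pullProb (gapMean ε a) t a ≤ π.pullProb (fun _ => 1 / 2 - ε) t a +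
      4 * ε ^ 2 * ∑ u ∈ Finset.range t, π.pullProb (fun _ => 1 / 2 - ε) u a + 7 / 40 := by
  classical
  have key := π.expect_le_log_expect_exp h0 h1 a t fun h => (-1) * if π.arm t h = a then 1 else 0
  have e : (fun h => Real.exp ((-1) * if π.arm t h = a then 1 else 0)) =
      fun h => 1 + (Real.exp (-1) - 1) * if π.arm t h = a then 1 else 0 := by
    funext h
    split_ifs <;> simp
  rw [e, expect_add, expect_const_mul, expect_const_mul, expect_const] at key
  have hx : π.expect (gapMean ε a) t (fun h => if π.arm t h = a then 1 else 0) =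
    π.pullProb (gapMean ε a) t a := by simp only [pullProb]
  have hy : π.expect (fun _ => 1 / 2 - ε) t (fun h => if π.arm t h = a then 1 else 0) =
    π.pullProb (fun _ => 1 / 2 - ε) t a := by simp only [pullProb]
  have hx0 : 0 ≤ π.pullProb (gapMean ε a) t a := by
    rw [← hx]
    refine (π.expect_const t 0).symm.trans_le (π.expect_mono (gapMean_mem h0 h1 a) t fun h => ?_)
    split_ifs <;> simp
  have hx1 : π.pullProb (gapMean ε a) t a ≤ 1 := by
    rw [← hx]
    refine (π.expect_mono (gapMean_mem h0 h1 a) t fun h => ?_).trans_eq (π.expect_const t 1)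
    split_ifs <;> simp
  rw [hx, hy] at key
  have := log_one_sub_mul_le hx0 hx1
  linarith

theorem sum_pullProb {Θ : Finset α} (hΘ : ∀ t h, π.arm t h ∈ Θ) (p : α → ℝ) (t : ℕ) :
    ∑ a ∈ Θ, π.pullProb p t a = 1 := by
  classical
  rw [← π.expect_const (p := p) t 1]
  simp only [pullProb]
  rw [← expect_sum]
  congr 1
  funext h
  simp [hΘ t h]

/-- On average over the choice of the best arm, the best arm is not pulled too often. -/
theorem sum_pullProb_gapMean_le {Θ : Finset α} (hΘ : ∀ t h, π.arm t h ∈ Θ) {ε : ℝ} (h0 : 0 ≤ ε)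
    (h1 : ε < 1 / 2) (n : ℕ) :
    ∑ a ∈ Θ, ∑ t ∈ Finset.range n, π.pullProb (gapMean ε a) t a ≤
      n + 2 * ε ^ 2 * n ^ 2 + 7 / 40 * Θ.card * n := by
  have hstep : ∀ t, ∑ a ∈ Θ, π.pullProb (gapMean ε a) t a ≤
      1 + 4 * ε ^ 2 * t + 7 / 40 * Θ.card := by
    intro t
    refine (Finset.sum_le_sum fun a _ => π.pullProb_gapMean_le h0 h1 a t).trans_eq ?_
    rw [Finset.sum_add_distrib, Finset.sum_add_distrib, ← Finset.mul_sum, Finset.sum_comm]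
    simp only [π.sum_pullProb hΘ, Finset.sum_const, Finset.card_range, nsmul_eq_mul]
    ring
  rw [Finset.sum_comm]
  refine (Finset.sum_le_sum fun t _ => hstep t).trans ?_
  induction n with
  | zero => simp
  | succ n ih =>
    rw [Finset.sum_range_succ]
    push_cast
    -- The new term 4ε²n is at most 2ε²((n+1)² - n²) = 2ε²(2n + 1).
    nlinarith [sq_nonneg ε]

end BernoulliPolicy

/-! ### Integrating out one coordinate of a product measure -/

/-- Resampling one coordinate independently does not change an i.i.d. family; this makes the fresh
weights a separate Fubini variable. -/
theorem measurePreserving_pi_update {ι X : Type*} [Fintype ι] [DecidableEq ι] [MeasurableSpace X]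
    (μ : Measure X) [IsProbabilityMeasure μ] (i : ι) :
    MeasurePreserving (fun z : (ι → X) × X => Function.update z.1 i z.2)
      ((Measure.pi fun _ => μ).prod μ) (Measure.pi fun _ => μ) := by
  have hm : Measurable fun z : (ι → X) × X => Function.update z.1 i z.2 := measurable_update'
  refine ⟨hm, (Measure.pi_eq fun s hs => ?_).symm⟩
  rw [Measure.map_apply hm (MeasurableSet.univ_pi hs)]
  have e : (fun z : (ι → X) × X => Function.update z.1 i z.2) ⁻¹' Set.univ.pi s =
      (Set.univ.pi (Function.update s i Set.univ)) ×ˢ s i := by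
    ext z
    simp only [Set.mem_preimage, Set.mem_pi, Set.mem_univ, true_implies, Set.mem_prod]
    constructor
    · intro h
      refine ⟨fun k => ?_, by simpa using h i⟩
      by_cases hk : k = i
      · subst hk; simp
      · simpa [hk] using h k
    · rintro ⟨h, h'⟩ k
      by_cases hk : k = i
      · subst hk; simpa using h'
      · simpa [hk] using h k
  rw [e, Measure.prod_prod, Measure.pi_pi, ← Finset.mul_prod_erase _ _ (Finset.mem_univ i),
    ← Finset.mul_prod_erase _ (fun k => μ (s k)) (Finset.mem_univ i)]
  simp only [Function.update_self, measure_univ, one_mul]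
  rw [mul_comm]
  congr 1
  exact Finset.prod_congr rfl fun k hk => by rw [Function.update_of_ne (Finset.ne_of_mem_erase hk)]

/-- A coordinate may be integrated out separately when the rest of the integrand does not
depend on it. -/
theorem integral_pi_eval_eq {ι X : Type*} [Fintype ι] [DecidableEq ι] [MeasurableSpace X]
    (μ : Measure X) [IsProbabilityMeasure μ] (i : ι) (F : (ι → X) → X → ℝ)
    (hF : ∀ w x y, F (Function.update w i y) x = F w x)
    (hint : Integrable (fun w => F w (w i)) (Measure.pi fun _ : ι => μ)) :
    ∫ w, F w (w i) ∂(Measure.pi fun _ : ι => μ) =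
      ∫ w, ∫ x, F w x ∂μ ∂(Measure.pi fun _ : ι => μ) := by
  have hmp := measurePreserving_pi_update μ i
  have h1 : Integrable (fun z : (ι → X) × X => F z.1 z.2) ((Measure.pi fun _ => μ).prod μ) := by
    have := hmp.integrable_comp_of_integrable hint
    simpa [Function.comp_def, hF] using this
  rw [← hmp.map_eq, integral_map hmp.measurable.aemeasurable
    (by rw [hmp.map_eq]; exact hint.aestronglyMeasurable), hmp.map_eq]
  simp only [hF, Function.update_self]
  exact integral_prod _ h1

/-! ### Paths, mean weights and the optimal return -/

section KPath

variable {L K : ℕ}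

theorem integral_comp_kPathLaw (h : K ∣ L) (j : Fin (L / K)) (Δ : ℝ)
    (hΔ : 0 < Δ / K ∧ Δ / K < 1 / 2) (i : Fin (L / K)) (g : ℝ → ℝ) (G : (Fin L → ℝ) → ℝ)
    (hG : Measurable G) (hg : ∀ x : Fin (L / K) → ℝ, G (fun e => x (pathIndex h e)) = g (x i))
    (hgm : Measurable g) :
    ∫ w, G w ∂kPathLaw h j Δ hΔ =
      kPathMean j Δ hΔ i * g 1 + (1 - kPathMean j Δ hΔ i) * g 0 := by
  rw [kPathLaw, integral_map (measurable_comp_pathIndex h).aemeasurable hG.aestronglyMeasurable]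
  simp only [hg]
  have hmp := measurePreserving_eval
    (fun i : Fin (L / K) => bernoulliMeasure (1 : ℝ) 0 (kPathMean j Δ hΔ i)) i
  have := integral_map (μ := Measure.pi fun i : Fin (L / K) =>
    bernoulliMeasure (1 : ℝ) 0 (kPathMean j Δ hΔ i)) hmp.measurable.aemeasurable
    (f := g) hgm.aestronglyMeasurable
  rw [hmp.map_eq, integral_bernoulliMeasure] at this
  simpa using this.symm

theorem card_pathItems (h : K ∣ L) (i : Fin (L / K)) : (pathItems h i).card = K := by
  have hi : (i : ℕ) < L / K := i.2
  have hK : 0 < K := by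
    rcases Nat.eq_zero_or_pos K with rfl | hK
    · simp at hi
    · exact hK
  have hle : (i : ℕ) * K + K ≤ L := by
    calc (i : ℕ) * K + K = (i + 1) * K := by ring
      _ ≤ L / K * K := Nat.mul_le_mul_right _ hi
      _ = L := Nat.div_mul_cancel h
  have e : (pathItems h i).map Fin.valEmbedding = Finset.Ico ((i : ℕ) * K) (i * K + K) := by
    ext x
    simp only [pathItems, pathIndex, Finset.mem_map, Finset.mem_filter, Finset.mem_univ, true_and,
      Fin.valEmbedding_apply, Finset.mem_Ico, Fin.ext_iff]
    constructor
    · rintro ⟨y, hy, rfl⟩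
      rw [← hy]
      exact ⟨Nat.div_mul_le_self _ _, by
        have := Nat.lt_div_mul_add hK (a := (y : ℕ)); exact this⟩
    · rintro ⟨h1, h2⟩
      refine ⟨⟨x, by omega⟩, ?_, rfl⟩
      exact Nat.div_eq_of_lt_le h1 (by rw [Nat.succ_mul]; exact h2)
  rw [← Finset.card_map Fin.valEmbedding, e]
  simp

theorem pathItems_injective (hK : 0 < K) (h : K ∣ L) : Function.Injective (pathItems h) := by
  intro i i' hii
  obtain ⟨e, he⟩ := Finset.card_pos.1 ((card_pathItems h i).symm ▸ hK)
  have he' := hii ▸ he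
  simp only [pathItems, Finset.mem_filter] at he he'
  exact he.2.symm.trans he'.2

theorem coe_kPathMean (hK : 0 < K) (h : K ∣ L) (j : Fin (L / K)) (Δ : ℝ)
    (hΔ : 0 < Δ / K ∧ Δ / K < 1 / 2) (i : Fin (L / K)) :
    (kPathMean j Δ hΔ i : ℝ) = gapMean (Δ / K) (pathItems h j) (pathItems h i) := by
  simp only [kPathMean, gapMean, (pathItems_injective hK h).eq_iff]

theorem meanWeight_kPathBandit (h : K ∣ L) (j : Fin (L / K)) (Δ : ℝ)
    (hΔ : 0 < Δ / K ∧ Δ / K < 1 / 2) (e : Fin L) :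
    (kPathBandit h j Δ hΔ).meanWeight e = kPathMean j Δ hΔ (pathIndex h e) := by
  refine (integral_comp_kPathLaw h j Δ hΔ (pathIndex h e) id (fun w => w e) (measurable_pi_apply e)
    (fun _ => rfl) measurable_id).trans ?_
  simp

theorem solutionReturn_meanWeight (hK : 0 < K) (h : K ∣ L) (j : Fin (L / K)) (Δ : ℝ)
    (hΔ : 0 < Δ / K ∧ Δ / K < 1 / 2) {A : Finset (Fin L)} (hA : A ∈ kPathFeasible h) :
    solutionReturn A (kPathBandit h j Δ hΔ).meanWeight = K * gapMean (Δ / K) (pathItems h j) A := by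
  obtain ⟨i, -, rfl⟩ := Finset.mem_image.1 hA
  have : ∀ e ∈ pathItems h i, (kPathBandit h j Δ hΔ).meanWeight e =
      gapMean (Δ / K) (pathItems h j) (pathItems h i) := by
    intro e he
    rw [meanWeight_kPathBandit, ← coe_kPathMean hK h j Δ hΔ i]
    simp only [pathItems, Finset.mem_filter] at he
    rw [he.2]
  rw [solutionReturn, Finset.sum_congr rfl this, Finset.sum_const, card_pathItems, nsmul_eq_mul]

/-- The optimal solution is an unspecified maximizer, so only its mean return is computed: no path
exceeds K/2, and path `j` attains it. -/
theorem solutionReturn_optimal_meanWeight (hK : 0 < K) (h : K ∣ L) (j : Fin (L / K)) (Δ : ℝ)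
    (hΔ : 0 < Δ / K ∧ Δ / K < 1 / 2) :
    solutionReturn (kPathBandit h j Δ hΔ).optimal (kPathBandit h j Δ hΔ).meanWeight = K / 2 := by
  obtain ⟨hmem, hopt⟩ := Classical.choose_spec (kPathBandit h j Δ hΔ).exists_optimal
  have hj := hopt _ (Finset.mem_image_of_mem (pathItems h) (Finset.mem_univ j))
  have e := solutionReturn_meanWeight hK h j Δ hΔ hmem
  rw [solutionReturn_meanWeight hK h j Δ hΔ
    (Finset.mem_image_of_mem (pathItems h) (Finset.mem_univ j))] at hj
  change solutionReturn (Classical.choose _) _ = _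
  have hK' : (0 : ℝ) < K := Nat.cast_pos.2 hK
  have hle : gapMean (Δ / K) (pathItems h j)
      (Classical.choose (kPathBandit h j Δ hΔ).exists_optimal) ≤ 1 / 2 := by
    unfold gapMean
    split_ifs <;> linarith [hΔ.1]
  rw [e] at hj ⊢
  have hj' := le_of_mul_le_mul_left hj hK'
  rw [gapMean, if_pos rfl] at hj'
  rw [le_antisymm hle hj']
  ring

end KPath

/-! ### Measurability, causality and the tree of an algorithm -/

section Measurability

variable {L : ℕ}

theorem measurable_observe :
    Measurable fun z : Finset (Fin L) × (Fin L → ℝ) => observe z.1 z.2 := by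
  refine measurable_fst.prodMk (measurable_pi_lambda _ fun e => ?_)
  refine Measurable.ite ?_ ((measurable_pi_apply e).comp measurable_snd) measurable_const
  exact measurable_fst (measurableSet_mem_finset e)

theorem measurable_fin_snoc {t : ℕ} {X : Type*} [MeasurableSpace X] :
    Measurable fun z : (Fin t → X) × X => (Fin.snoc z.1 z.2 : Fin (t + 1) → X) := by
  refine measurable_pi_lambda _ fun i => ?_
  induction i using Fin.lastCases with
  | last => simpa using measurable_snd
  | cast i => simpa [Function.comp_def] using (measurable_pi_apply i).comp measurable_fst

variable {Θ : Finset (Finset (Fin L))} (alg : SemiBanditAlgorithm.{u} Θ) {n : ℕ}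

namespace SemiBanditAlgorithm

theorem measurable_history (t : ℕ) (ht : t ≤ n) :
    Measurable fun x : alg.Seed × (Fin n → Fin L → ℝ) => alg.history x.1 x.2 t ht := by
  induction t with
  | zero => exact measurable_const
  | succ t ih =>
    have ih := ih (Nat.le_of_succ_le ht)
    refine measurable_fin_snoc.comp (ih.prodMk (measurable_observe.comp (Measurable.prodMk ?_ ?_)))
    · exact (alg.measurable_choose t).comp (measurable_fst.prodMk ih)
    · exact (measurable_pi_apply _).comp measurable_snd

theorem measurable_action (t : Fin n) :
    Measurable fun x : alg.Seed × (Fin n → Fin L → ℝ) => alg.action x.1 x.2 t :=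
  (alg.measurable_choose t).comp (measurable_fst.prodMk (alg.measurable_history t _))

theorem history_update (s : alg.Seed) (w : Fin n → Fin L → ℝ) (i : Fin n) (y : Fin L → ℝ) (t : ℕ)
    (ht : t ≤ n) (hti : t ≤ i) :
    alg.history s (Function.update w i y) t ht = alg.history s w t ht := by
  induction t with
  | zero => rfl
  | succ t ih =>
    have : (⟨t, ht⟩ : Fin n) ≠ i := fun hi => by
      have := congrArg Fin.val hi
      simp only at this
      omega
    simp only [history, ih (Nat.le_of_succ_le ht) (by omega), Function.update_of_ne this]

/-- The decision tree of the algorithm when its seed is `s` and all observed weights of a chosen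
solution are equal. -/
def policy (s : alg.Seed) : BernoulliPolicy (Finset (Fin L)) where
  node t := Fin t → Observation L
  root := Fin.elim0
  arm t h := alg.choose t (s, h)
  next t h b := Fin.snoc (α := fun _ => Observation L) h
    (observe (alg.choose t (s, h)) fun _ => if b then 1 else 0)

end SemiBanditAlgorithm

end Measurability

/-! ### From the semi-bandit to the decision tree -/

section Link

variable {L K : ℕ} (hdvd : K ∣ L) (j : Fin (L / K)) {Δ : ℝ} (hΔ : 0 < Δ / K ∧ Δ / K < 1 / 2)
  (alg : SemiBanditAlgorithm.{u} (kPathFeasible hdvd))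

instance : IsProbabilityMeasure (kPathLaw hdvd j Δ hΔ) := isProbabilityMeasure_kPathLaw hdvd j Δ hΔ

theorem integral_observe (hK : 0 < K) {A : Finset (Fin L)} (hA : A ∈ kPathFeasible hdvd)
    (g : Observation L → ℝ) (hg : Measurable g) :
    ∫ x, g (observe A x) ∂kPathLaw hdvd j Δ hΔ =
      gapMean (Δ / K) (pathItems hdvd j) A * g (observe A fun _ => 1) +
        (1 - gapMean (Δ / K) (pathItems hdvd j) A) * g (observe A fun _ => 0) := by
  obtain ⟨i, -, rfl⟩ := Finset.mem_image.1 hA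
  rw [← coe_kPathMean hK hdvd j Δ hΔ i]
  have hm : Measurable fun x : Fin L → ℝ => observe (pathItems hdvd i) x :=
    measurable_observe.comp measurable_prodMk_left
  refine integral_comp_kPathLaw hdvd j Δ hΔ i (fun r => g (observe (pathItems hdvd i) fun _ => r))
    _ (hg.comp hm) (fun x => ?_) ((hg.comp hm).comp (measurable_pi_lambda _ fun _ => measurable_id))
  congr 1
  refine Prod.ext rfl (funext fun e => ?_)
  simp only [observe]
  refine ite_congr rfl (fun he => ?_) fun _ => rfl
  simp only [pathItems, Finset.mem_filter] at he
  rw [he.2]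

/-- The weights of the last step are independent of the history that selects the path, and on that
path they amount to one Bernoulli bit; integrating them out is exactly one `step` of the tree. -/
theorem integral_history (hK : 0 < K) (s : alg.Seed) {n : ℕ} (t : ℕ) (ht : t ≤ n)
    (g : (Fin t → Observation L) → ℝ) (hg : Measurable g) (C : ℝ) (hC : ∀ h, |g h| ≤ C) :
    ∫ w, g (alg.history s w t ht) ∂(Measure.pi fun _ : Fin n => kPathLaw hdvd j Δ hΔ) =
      (alg.policy s).expect (gapMean (Δ / K) (pathItems hdvd j)) t g := by
  induction t with
  | zero =>
    have : ∀ w, alg.history s w 0 ht = (alg.policy s).root := fun _ => rfl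
    simp only [this]
    simp [BernoulliPolicy.expect]
  | succ t ih =>
    have ht' : t ≤ n := Nat.le_of_succ_le ht
    have hch : Measurable fun h : Fin t → Observation L => alg.choose t (s, h) :=
      (alg.measurable_choose t).comp measurable_prodMk_left
    have hhist : ∀ t ht, Measurable fun w : Fin n → Fin L → ℝ => alg.history s w t ht :=
      fun t ht => (alg.measurable_history t ht).comp measurable_prodMk_left
    have hstep : ∀ h : Fin t → Observation L,
        ∫ x, g (Fin.snoc h (observe (alg.choose t (s, h)) x)) ∂kPathLaw hdvd j Δ hΔ =
          (alg.policy s).step (gapMean (Δ / K) (pathItems hdvd j)) t g h := by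
      intro h
      rw [integral_observe hdvd j hΔ hK (alg.choose_mem t (s, h)) (fun o => g (Fin.snoc h o))
        (hg.comp (measurable_fin_snoc.comp measurable_prodMk_left))]
      simp [BernoulliPolicy.step, SemiBanditAlgorithm.policy]
    have hnext : ∀ b, Measurable fun h : Fin t → Observation L => g ((alg.policy s).next t h b) := fun b =>
      hg.comp (measurable_fin_snoc.comp (measurable_id.prodMk
        (measurable_observe.comp (hch.prodMk measurable_const))))
    have hmean : Measurable fun h : Fin t → Observation L =>
        gapMean (Δ / K) (pathItems hdvd j) (alg.choose t (s, h)) :=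
      (measurable_of_countable (gapMean (Δ / K) (pathItems hdvd j))).comp hch
    have hF : Integrable (fun w : Fin n → Fin L → ℝ => g (alg.history s w (t + 1) ht))
        (Measure.pi fun _ : Fin n => kPathLaw hdvd j Δ hΔ) :=
      Integrable.of_bound (hg.comp (hhist _ _)).aestronglyMeasurable C
        (ae_of_all _ fun w => hC _)
    have key := integral_pi_eval_eq (kPathLaw hdvd j Δ hΔ) (⟨t, ht⟩ : Fin n)
      (fun w x => g (Fin.snoc (alg.history s w t ht')
        (observe (alg.choose t (s, alg.history s w t ht')) x)))
      (fun w x y => by rw [alg.history_update s w _ y t ht' le_rfl]) hF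
    refine key.trans ?_
    simp only [hstep]
    refine ih ht' _ ?_ ?_
    · exact (hmean.mul (hnext true)).add ((measurable_const.sub hmean).mul (hnext false))
    -- A step is a convex combination of two values of `g`, so the same bound C persists.
    · intro h
      obtain ⟨h0, h1⟩ := BernoulliPolicy.gapMean_mem hΔ.1.le hΔ.2 (pathItems hdvd j)
        (alg.choose t (s, h))
      have a1 := abs_le.1 (hC ((alg.policy s).next t h true))
      have a2 := abs_le.1 (hC ((alg.policy s).next t h false))
      change |gapMean (Δ / K) (pathItems hdvd j) (alg.choose t (s, h)) * _ +
        (1 - gapMean (Δ / K) (pathItems hdvd j) (alg.choose t (s, h))) * _| ≤ C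
      rw [abs_le]
      constructor <;> nlinarith

theorem ae_kPathLaw_pi (n : ℕ) (t : Fin n) :
    ∀ᵐ w ∂(Measure.pi fun _ : Fin n => kPathLaw hdvd j Δ hΔ), ∀ e, w t e ∈ Set.Icc (0 : ℝ) 1 :=
  (measurePreserving_eval (fun _ : Fin n => kPathLaw hdvd j Δ hΔ) t).quasiMeasurePreserving.ae
    (kPathLaw_cube hdvd j Δ hΔ)

theorem abs_solutionReturn_le {A : Finset (Fin L)} {w : Fin L → ℝ}
    (hw : ∀ e, w e ∈ Set.Icc (0 : ℝ) 1) : |solutionReturn A w| ≤ L := by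
  have h0 : 0 ≤ solutionReturn A w := Finset.sum_nonneg fun e _ => (hw e).1
  rw [abs_of_nonneg h0]
  calc solutionReturn A w ≤ ∑ e ∈ A, (1 : ℝ) := Finset.sum_le_sum fun e _ => (hw e).2
    _ ≤ L := by
      simp only [Finset.sum_const, nsmul_eq_mul, mul_one]
      exact_mod_cast (Finset.card_le_univ A).trans_eq (Fintype.card_fin L)

theorem measurable_solutionReturn :
    Measurable fun z : Finset (Fin L) × (Fin L → ℝ) => solutionReturn z.1 z.2 := by
  refine measurable_from_prod_countable_right fun A => ?_
  exact Finset.measurable_sum _ fun e _ => measurable_pi_apply e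

theorem integral_solutionReturn (A : Finset (Fin L)) :
    ∫ w, solutionReturn A w ∂kPathLaw hdvd j Δ hΔ =
      solutionReturn A (kPathBandit hdvd j Δ hΔ).meanWeight := by
  refine integral_finsetSum _ fun e _ => ?_
  refine Integrable.of_bound (measurable_pi_apply e).aestronglyMeasurable 1 ?_
  filter_upwards [kPathLaw_cube hdvd j Δ hΔ] with w hw
  rw [Real.norm_eq_abs, abs_le]
  constructor <;> linarith [(hw e).1, (hw e).2]

/-- The expected return of step `t`, given the seed. -/
theorem integral_solutionReturn_action (hK : 0 < K) (s : alg.Seed) {n : ℕ} (t : Fin n) :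
    ∫ w, solutionReturn (alg.action s w t) (w t)
        ∂(Measure.pi fun _ : Fin n => kPathLaw hdvd j Δ hΔ) =
      K * (1 / 2 - Δ / K) + Δ / K * K * (alg.policy s).pullProb
        (gapMean (Δ / K) (pathItems hdvd j)) t (pathItems hdvd j) := by
  classical
  have hch : Measurable fun h : Fin t → Observation L => alg.choose t (s, h) :=
    (alg.measurable_choose t).comp measurable_prodMk_left
  have hact : Measurable fun w : Fin n → Fin L → ℝ => alg.action s w t :=
    (alg.measurable_action t).comp measurable_prodMk_left
  rw [integral_pi_eval_eq (kPathLaw hdvd j Δ hΔ) t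
    (fun w x => solutionReturn (alg.action s w t) x)]
  · simp only [integral_solutionReturn]
    have h1 : ∀ w : Fin n → Fin L → ℝ, solutionReturn (alg.action s w t)
        (kPathBandit hdvd j Δ hΔ).meanWeight =
        K * (1 / 2 - Δ / K) + Δ / K * K *
          (if alg.choose t (s, alg.history s w t t.isLt.le) = pathItems hdvd j then 1 else 0) := by
      intro w
      rw [SemiBanditAlgorithm.action,
        solutionReturn_meanWeight hK hdvd j Δ hΔ (alg.choose_mem _ _), gapMean]
      split_ifs <;> ring
    simp only [h1]
    have hind : Measurable fun h : Fin t → Observation L =>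
        if alg.choose t (s, h) = pathItems hdvd j then (1 : ℝ) else 0 :=
      (measurable_of_countable fun A : Finset (Fin L) =>
        if A = pathItems hdvd j then (1 : ℝ) else 0).comp hch
    have hb : ∀ h : Fin t → Observation L,
        |if alg.choose t (s, h) = pathItems hdvd j then (1 : ℝ) else 0| ≤ 1 := fun h => by
      split_ifs <;> simp
    have hint : Integrable (fun w : Fin n → Fin L → ℝ =>
        if alg.choose t (s, alg.history s w t t.isLt.le) = pathItems hdvd j then (1 : ℝ) else 0)
        (Measure.pi fun _ : Fin n => kPathLaw hdvd j Δ hΔ) :=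
      Integrable.of_bound (hind.comp ((alg.measurable_history t _).comp
        measurable_prodMk_left)).aestronglyMeasurable 1 (ae_of_all _ fun w => hb _)
    rw [integral_add (integrable_const _) (hint.const_mul _), integral_const_mul (Δ / K * K),
      integral_history hdvd j hΔ alg hK s t t.isLt.le _ hind 1 hb]
    simp only [integral_const, probReal_univ, one_smul, BernoulliPolicy.pullProb]
    congr 2
    refine congrArg _ (funext fun h => ?_)
    by_cases hh : alg.choose t (s, h) = pathItems hdvd j
    · rw [if_pos hh]
      exact (if_pos hh).symm
    · rw [if_neg hh]
      exact (if_neg hh).symm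
  · intro w x y
    simp only [SemiBanditAlgorithm.action]
    rw [alg.history_update s w t y t t.isLt.le le_rfl]
  · refine Integrable.of_bound (measurable_solutionReturn.comp
      (hact.prodMk (measurable_pi_apply t))).aestronglyMeasurable L ?_
    filter_upwards [ae_kPathLaw_pi hdvd j hΔ n t] with w hw
    exact abs_solutionReturn_le hw

theorem integrable_solutionReturn_sub (n : ℕ) (t : Fin n) (B : Finset (Fin L)) :
    Integrable (fun x : alg.Seed × (Fin n → Fin L → ℝ) =>
      solutionReturn B (x.2 t) - solutionReturn (alg.action x.1 x.2 t) (x.2 t))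
      (alg.seedLaw.prod (Measure.pi fun _ : Fin n => kPathLaw hdvd j Δ hΔ)) := by
  have hw : ∀ᵐ x ∂(alg.seedLaw.prod (Measure.pi fun _ : Fin n => kPathLaw hdvd j Δ hΔ)),
      ∀ e, x.2 t e ∈ Set.Icc (0 : ℝ) 1 :=
    Measure.quasiMeasurePreserving_snd.ae (ae_kPathLaw_pi hdvd j hΔ n t)
  have ht : Measurable fun x : alg.Seed × (Fin n → Fin L → ℝ) => x.2 t :=
    (measurable_pi_apply t).comp measurable_snd
  refine Integrable.sub ?_ ?_
  · refine Integrable.of_bound (measurable_solutionReturn.comp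
      (measurable_const.prodMk ht)).aestronglyMeasurable L ?_
    filter_upwards [hw] with x hx
    exact abs_solutionReturn_le hx
  · refine Integrable.of_bound (measurable_solutionReturn.comp
      ((alg.measurable_action t).prodMk ht)).aestronglyMeasurable L ?_
    filter_upwards [hw] with x hx
    exact abs_solutionReturn_le hx

/-- The regret, given the seed, in terms of the probabilities of the optimal choice. -/
noncomputable def seedRegret (n : ℕ) (s : alg.Seed) : ℝ :=
  ∫ w, ∑ t : Fin n, (solutionReturn (kPathBandit hdvd j Δ hΔ).optimal (w t) -
    solutionReturn (alg.action s w t) (w t)) ∂(Measure.pi fun _ : Fin n => kPathLaw hdvd j Δ hΔ)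

theorem regret_eq_integral_seedRegret (n : ℕ) :
    Integrable (seedRegret hdvd j hΔ alg n) alg.seedLaw ∧
      (kPathBandit hdvd j Δ hΔ).regret alg n =
        ∫ s, seedRegret hdvd j hΔ alg n s ∂alg.seedLaw := by
  have h := integrable_finsetSum Finset.univ fun t _ =>
    integrable_solutionReturn_sub hdvd j hΔ alg n t (kPathBandit hdvd j Δ hΔ).optimal
  have e : (kPathBandit hdvd j Δ hΔ).regret alg n =
      ∫ x : alg.Seed × (Fin n → Fin L → ℝ),
        ∑ t : Fin n, (solutionReturn (kPathBandit hdvd j Δ hΔ).optimal (x.2 t) -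
          solutionReturn (alg.action x.1 x.2 t) (x.2 t))
        ∂(alg.seedLaw.prod (Measure.pi fun _ : Fin n => kPathLaw hdvd j Δ hΔ)) := rfl
  exact ⟨h.integral_prod_left, e.trans (integral_prod _ h)⟩

theorem seedRegret_eq (hK : 0 < K) (n : ℕ) (s : alg.Seed) :
    seedRegret hdvd j hΔ alg n s = K * (Δ / K) * (n - ∑ t ∈ Finset.range n,
      (alg.policy s).pullProb (gapMean (Δ / K) (pathItems hdvd j)) t (pathItems hdvd j)) := by
  have hint : ∀ (t : Fin n) (f : (Fin n → Fin L → ℝ) → Finset (Fin L)), Measurable f →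
      Integrable (fun w => solutionReturn (f w) (w t))
        (Measure.pi fun _ : Fin n => kPathLaw hdvd j Δ hΔ) := by
    intro t f hf
    refine Integrable.of_bound (measurable_solutionReturn.comp
      (hf.prodMk (measurable_pi_apply t))).aestronglyMeasurable L ?_
    filter_upwards [ae_kPathLaw_pi hdvd j hΔ n t] with w hw
    exact abs_solutionReturn_le hw
  have hopt : ∀ t : Fin n, Integrable (fun w => solutionReturn (kPathBandit hdvd j Δ hΔ).optimal
      (w t)) (Measure.pi fun _ : Fin n => kPathLaw hdvd j Δ hΔ) :=
    fun t => hint t _ measurable_const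
  have hact : ∀ t : Fin n, Integrable (fun w => solutionReturn (alg.action s w t) (w t))
      (Measure.pi fun _ : Fin n => kPathLaw hdvd j Δ hΔ) :=
    fun t => hint t _ ((alg.measurable_action t).comp measurable_prodMk_left)
  have hval : ∀ t : Fin n, ∫ w, solutionReturn (kPathBandit hdvd j Δ hΔ).optimal (w t)
      ∂(Measure.pi fun _ : Fin n => kPathLaw hdvd j Δ hΔ) = K / 2 := by
    intro t
    -- Here the integrand is independent of the first argument, so this merely takes the marginal at
    -- `t`.
    rw [integral_pi_eval_eq (kPathLaw hdvd j Δ hΔ) t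
      (fun _ x => solutionReturn (kPathBandit hdvd j Δ hΔ).optimal x) (fun _ _ _ => rfl) (hopt t)]
    simp only [integral_solutionReturn, solutionReturn_optimal_meanWeight hK]
    simp
  rw [seedRegret, integral_finsetSum _ fun t _ => show Integrable (fun w =>
    solutionReturn (kPathBandit hdvd j Δ hΔ).optimal (w t) -
      solutionReturn (alg.action s w t) (w t)) _ from (hopt t).sub (hact t)]
  simp only [integral_sub (hopt _) (hact _), hval,
    integral_solutionReturn_action hdvd j hΔ alg hK s]
  rw [Fin.sum_univ_eq_sum_range fun t => (K : ℝ) / 2 - (K * (1 / 2 - Δ / K) + Δ / K * K *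
    (alg.policy s).pullProb (gapMean (Δ / K) (pathItems hdvd j)) t (pathItems hdvd j))]
  rw [Finset.sum_sub_distrib, Finset.sum_add_distrib]
  simp only [Finset.sum_const, Finset.card_range, nsmul_eq_mul]
  rw [← Finset.mul_sum]
  ring

/-- The pull-count bound holds for every seed with the same constant, so it survives integration
over the seed. -/
theorem le_sum_regret (hK : 0 < K) (n : ℕ) :
    Δ * ((L / K : ℕ) * n - (n + 2 * (Δ / K) ^ 2 * n ^ 2 + 7 / 40 * (L / K : ℕ) * n)) ≤
      ∑ j : Fin (L / K), (kPathBandit hdvd j Δ hΔ).regret alg n := by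
  have hK' : (0 : ℝ) < K := Nat.cast_pos.2 hK
  have hΔ0 : K * (Δ / K) = Δ := mul_div_cancel₀ _ hK'.ne'
  have hpos : 0 < Δ := by rw [← hΔ0]; exact mul_pos hK' hΔ.1
  have hcard : (kPathFeasible hdvd).card = L / K := by
    rw [kPathFeasible, Finset.card_image_of_injective _ (pathItems_injective hK hdvd)]
    simp
  have hseed : ∀ s : alg.Seed,
      Δ * ((L / K : ℕ) * n - (n + 2 * (Δ / K) ^ 2 * n ^ 2 + 7 / 40 * (L / K : ℕ) * n)) ≤
        ∑ j : Fin (L / K), seedRegret hdvd j hΔ alg n s := by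
    intro s
    have key := (alg.policy s).sum_pullProb_gapMean_le (Θ := kPathFeasible hdvd)
      (fun t h => alg.choose_mem t (s, h)) hΔ.1.le hΔ.2 n
    have hsum : ∀ f : Finset (Fin L) → ℝ,
        ∑ A ∈ kPathFeasible hdvd, f A = ∑ j, f (pathItems hdvd j) := fun f =>
      Finset.sum_image fun _ _ _ _ h => pathItems_injective hK hdvd h
    rw [hcard, hsum] at key
    simp only [seedRegret_eq hdvd _ hΔ alg hK, hΔ0]
    rw [← Finset.mul_sum, Finset.sum_sub_distrib]
    simp only [Finset.sum_const, Finset.card_univ, Fintype.card_fin, nsmul_eq_mul]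
    exact mul_le_mul_of_nonneg_left (sub_le_sub_left key _) hpos.le
  simp only [(regret_eq_integral_seedRegret hdvd _ hΔ alg n).2]
  rw [← integral_finsetSum _ fun j _ => (regret_eq_integral_seedRegret hdvd j hΔ alg n).1]
  have := integral_mono (μ := alg.seedLaw) (integrable_const _)
    (integrable_finsetSum _ fun j _ => (regret_eq_integral_seedRegret hdvd j hΔ alg n).1) hseed
  simpa using this

end Link

/-! ### Choice of the gap and conclusion -/

theorem mainTheorem4 (L K n : ℕ) (hK : 0 < K) (hdvd : K ∣ L) (hKL : K < L) (hn : 0 < n) :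
    ∃ (Δ : ℝ) (hΔ : 0 < Δ / K ∧ Δ / K < 1 / 2),
      ∀ alg : SemiBanditAlgorithm.{u} (kPathFeasible hdvd),
        (1 / 20 * min (√((K : ℝ) * L * n)) ((K : ℝ) * n) ≤
          (∑ j : Fin (L / K), (kPathBandit hdvd j Δ hΔ).regret alg n) / ((L : ℝ) / K)) ∧
        ∃ j : Fin (L / K),
          1 / 20 * min (√((K : ℝ) * L * n)) ((K : ℝ) * n) ≤
            (kPathBandit hdvd j Δ hΔ).regret alg n := by
  have hK' : (0 : ℝ) < K := Nat.cast_pos.2 hK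
  have hn' : (0 : ℝ) < n := Nat.cast_pos.2 hn
  obtain ⟨m, rfl⟩ := hdvd
  have hm : 2 ≤ m := by
    by_contra! h
    have : K * m ≤ K * 1 := Nat.mul_le_mul_left _ (by omega)
    omega
  have hm' : (2 : ℝ) ≤ m := by exact_mod_cast hm
  have hdiv : K * m / K = m := Nat.mul_div_cancel_left _ hK
  have hcast : ((K * m : ℕ) : ℝ) / K = m := by
    push_cast
    exact mul_div_cancel_left₀ _ hK'.ne'
  set r : ℝ := min (√(m * n)) n with hr
  have hsqrt : √((K : ℝ) * (K * m : ℕ) * n) = K * √(m * n) := by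
    rw [show (K : ℝ) * (K * m : ℕ) * n = K ^ 2 * (m * n) by push_cast; ring,
      Real.sqrt_mul (sq_nonneg _), Real.sqrt_sq hK'.le]
  have hmin : min (√((K : ℝ) * (K * m : ℕ) * n)) ((K : ℝ) * n) = K * r := by
    rw [hsqrt, hr, mul_min_of_nonneg _ _ hK'.le]
  have hr0 : 0 < r := lt_min (Real.sqrt_pos.2 (by positivity)) hn'
  have hrn : r ≤ n := min_le_right _ _
  have hrm : r ^ 2 ≤ m * n := by
    calc r ^ 2 ≤ √((m : ℝ) * n) ^ 2 := by gcongr; exact min_le_left _ _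
      _ = (m : ℝ) * n := Real.sq_sqrt (by positivity)
  have hε : K * (r / (4 * n)) / K = r / (4 * n) := mul_div_cancel_left₀ _ hK'.ne'
  have hΔ : 0 < K * (r / (4 * n)) / K ∧ K * (r / (4 * n)) / K < 1 / 2 := by
    rw [hε]
    refine ⟨by positivity, ?_⟩
    rw [div_lt_iff₀ (by positivity)]
    linarith
  -- Thus ε = r/(4n): r ≤ n keeps ε ≤ 1/4, and r² ≤ mn makes the entropy term 2ε²n² = r²/8 at most
  -- mn/8.
  refine ⟨K * (r / (4 * n)), hΔ, fun alg => ?_⟩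
  have key := le_sum_regret _ hΔ alg hK n
  have hmR : ((K * m / K : ℕ) : ℝ) = m := by rw [hdiv]
  rw [hε, hmR] at key
  have hbound : 1 / 20 * (K * r) * m ≤
      ∑ j : Fin (K * m / K), (kPathBandit _ j _ hΔ).regret alg n := by
    refine le_trans ?_ key
    have e : (2 : ℝ) * (r / (4 * n)) ^ 2 * n ^ 2 = r ^ 2 / 8 := by
      field_simp
      norm_num
    -- As m ≥ 2 gives n ≤ mn/2, the fraction left is 1 - 1/2 - 1/8 - 7/40 = 1/5; with the factor 1/4
    -- from ε this yields 1/20.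
    have h4 : 1 / 5 * m * n ≤ m * n - (n + 2 * (r / (4 * n)) ^ 2 * n ^ 2 + 7 / 40 * m * n) := by
      rw [e]
      nlinarith
    calc 1 / 20 * (K * r) * m = K * (r / (4 * n)) * (1 / 5 * m * n) := by
          field_simp
          norm_num
      _ ≤ _ := mul_le_mul_of_nonneg_left h4 (by positivity)
  rw [hmin, hcast]
  refine ⟨(le_div_iff₀ (by linarith)).2 hbound, ?_⟩
  by_contra! hlt
  have hne : (Finset.univ : Finset (Fin (K * m / K))).Nonempty :=
    ⟨⟨0, by rw [hdiv]; omega⟩, Finset.mem_univ _⟩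
  have := Finset.sum_lt_sum_of_nonempty hne fun j _ => hlt j
  simp only [Finset.sum_const, Finset.card_univ, Fintype.card_fin, nsmul_eq_mul, hmR] at this
  linarith
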